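/- Let $K$ be a field and let $G$ be a forest (a finite simple graph without cycles) on $n \geq 4$ vertices $1,\dots,n$. Let $S = K[x_1,\dots,x_n,y_1,\dots,y_n]$ with the standard grading, and let $J_G = (x_i y_j - x_j y_i : i<j,\ \{i,j\} \in E(G)) \subseteq S$ be the binomial edge ideal of $G$. For $i,j\ge 0$ let $\beta_{i,j}(J_G) = \dim_K \operatorname{Tor}_i^S(J_G,K)_j$ be the graded Betti numbers of $J_G$, regarded as a graded $S$-module; that is, $\beta_{i,j}(J_G)$ is the number of copies of $S(-j)$ in homological degree $i$ of the minimal graded free resolution of $J_G$. Then $\beta_{1,j}(J_G) = 0$ for all $j > n$. -/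

import Mathlib

open MvPolynomial

noncomputable section

namespace BinomialEdge

attribute [local instance] MvPolynomial.gradedAlgebra

/-- The binomial edge ideal `J_G` of a graph `G` on the vertex set `V`, in the polynomial ring
`S = K[x_v, y_v : v ∈ V]` with `x_v = X (Sum.inl v)` and `y_v = X (Sum.inr v)`. It is generated by
the binomials `f_{ij} = x_i y_j - x_j y_i`, where `{i, j}` runs over the edges of `G`
(exchanging `i` and `j` only changes the sign). -/
def binomialEdgeIdeal (K : Type*) [Field K] {V : Type*} (G : SimpleGraph V) :
    Ideal (MvPolynomial (V ⊕ V) K) :=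
  Ideal.span {f | ∃ i j : V, G.Adj i j ∧
    f = X (Sum.inl i) * X (Sum.inr j) - X (Sum.inl j) * X (Sum.inr i)}

/-- The binomial edge ideal is homogeneous for the standard grading of `S`. -/
theorem binomialEdgeIdeal_isHomogeneous (K : Type*) [Field K] {V : Type*} (G : SimpleGraph V) :
    (binomialEdgeIdeal K G).IsHomogeneous (homogeneousSubmodule (V ⊕ V) K) := by
  apply Ideal.homogeneous_span
  rintro _ ⟨i, j, -, rfl⟩
  refine ⟨2, ?_⟩
  rw [mem_homogeneousSubmodule]
  exact ((isHomogeneous_X K _).mul (isHomogeneous_X K _)).sub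
    ((isHomogeneous_X K _).mul (isHomogeneous_X K _))

/-- A vector `v` of the graded free module `⨁_c S(-deg c)`, `c < r`, is homogeneous of degree `k`:
each monomial `m` of the coordinate `v c` satisfies `deg m + deg c = k`. -/
def IsHomogeneousVec {σ K : Type*} [Field K] {r : ℕ} (deg : Fin r → ℕ) (k : ℕ)
    (v : Fin r → MvPolynomial σ K) : Prop :=
  ∀ c, ∀ m ∈ (v c).support, m.degree + deg c = k

/-- A graded free resolution
`⋯ → F 2 → F 1 → F 0 → I → 0` of an ideal `I` of `S = K[σ]`, regarded as a graded `S`-module,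
by finitely generated graded free modules `F i = ⨁_b S(-deg i b)`, `b < rank i`, all maps being
homogeneous of degree zero. -/
structure GradedFreeResolution {σ K : Type*} [Field K] (I : Ideal (MvPolynomial σ K)) where
  /-- the rank of `F i` -/
  rank : ℕ → ℕ
  /-- the degrees of the basis elements of `F i` -/
  deg : ∀ i, Fin (rank i) → ℕ
  /-- the augmentation `F 0 → I ⊆ S` -/
  aug : (Fin (rank 0) → MvPolynomial σ K) →ₗ[MvPolynomial σ K] MvPolynomial σ K
  /-- the differential `F (i + 1) → F i` -/
  d : ∀ i, (Fin (rank (i + 1)) → MvPolynomial σ K) →ₗ[MvPolynomial σ K]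
    (Fin (rank i) → MvPolynomial σ K)
  aug_homogeneous : ∀ b, (aug (Pi.single b 1)).IsHomogeneous (deg 0 b)
  d_homogeneous : ∀ i b, IsHomogeneousVec (deg i) (deg (i + 1) b) (d i (Pi.single b 1))
  range_aug : LinearMap.range aug = I
  exact_zero : LinearMap.range (d 0) = LinearMap.ker aug
  exact_succ : ∀ i, LinearMap.range (d (i + 1)) = LinearMap.ker (d i)

/-- A graded free resolution is minimal if the image of each differential `F (i + 1) → F i` lies
in `𝔪 F i`, where `𝔪` is the ideal of polynomials without constant term. -/
def GradedFreeResolution.IsMinimal {σ K : Type*} [Field K] {I : Ideal (MvPolynomial σ K)}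
    (F : GradedFreeResolution I) : Prop :=
  ∀ i v c, constantCoeff (F.d i v c) = 0

/-- The number of copies of `S(-j)` in the `i`-th module of a graded free resolution. -/
def GradedFreeResolution.multiplicity {σ K : Type*} [Field K] {I : Ideal (MvPolynomial σ K)}
    (F : GradedFreeResolution I) (i j : ℕ) : ℕ :=
  Fintype.card {b : Fin (F.rank i) // F.deg i b = j}

/-! ### Existence of minimal graded free resolutions -/

section Existence

variable {σ K : Type*} [Field K]

/-- The degree `k` part of `a ∈ S(-e)`. -/
def shiftComp (e k : ℕ) (a : MvPolynomial σ K) : MvPolynomial σ K :=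
  if e ≤ k then homogeneousComponent (k - e) a else 0

theorem coeff_shiftComp (e k : ℕ) (a : MvPolynomial σ K) (m : σ →₀ ℕ) :
    coeff m (shiftComp e k a) = if m.degree + e = k then coeff m a else 0 := by
  unfold shiftComp
  split_ifs with h1 h2 h2
  · rw [coeff_homogeneousComponent, if_pos (by omega)]
  · rw [coeff_homogeneousComponent, if_neg (by omega)]
  · omega
  · simp

theorem shiftComp_mul (e d k : ℕ) (a p : MvPolynomial σ K)
    (hp : ∀ m ∈ p.support, m.degree + e = d) :
    shiftComp e k (a * p) = shiftComp d k a * p := by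
  classical
  ext m
  have key : ∀ x ∈ Finset.HasAntidiagonal.antidiagonal m, coeff x.1 (shiftComp d k a) * coeff x.2 p =
      if m.degree + e = k then coeff x.1 a * coeff x.2 p else 0 := by
    intro x hx
    rw [Finset.HasAntidiagonal.mem_antidiagonal] at hx
    rw [coeff_shiftComp]
    by_cases h0 : coeff x.2 p = 0
    · simp [h0]
    · have h1 := hp x.2 (mem_support_iff.2 h0)
      have h2 : m.degree = x.1.degree + x.2.degree := by rw [← hx, map_add]
      by_cases h3 : m.degree + e = k
      · rw [if_pos h3, if_pos (by omega)]
      · rw [if_neg h3, if_neg (by omega), zero_mul]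
  rw [coeff_shiftComp, coeff_mul, coeff_mul, Finset.sum_congr rfl key]
  split_ifs <;> simp

theorem shiftComp_sum (e k : ℕ) {ι : Type*} (s : Finset ι) (f : ι → MvPolynomial σ K) :
    shiftComp e k (∑ i ∈ s, f i) = ∑ i ∈ s, shiftComp e k (f i) := by
  unfold shiftComp
  split_ifs <;> simp

/-- The degree `k` part of a vector of `⨁_c S(-deg c)`. -/
def vecComp {r : ℕ} (deg : Fin r → ℕ) (k : ℕ) (v : Fin r → MvPolynomial σ K) :
    Fin r → MvPolynomial σ K :=
  fun c => shiftComp (deg c) k (v c)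

theorem vecComp_isHomogeneousVec {r : ℕ} (deg : Fin r → ℕ) (k : ℕ)
    (v : Fin r → MvPolynomial σ K) : IsHomogeneousVec deg k (vecComp deg k v) := by
  intro c m hm
  rw [mem_support_iff, vecComp, coeff_shiftComp] at hm
  by_contra h
  exact hm (if_neg h)

theorem vecComp_of_isHomogeneousVec {r : ℕ} {deg : Fin r → ℕ} {k : ℕ}
    {v : Fin r → MvPolynomial σ K} (hv : IsHomogeneousVec deg k v) : vecComp deg k v = v := by
  funext c
  ext m
  rw [vecComp, coeff_shiftComp]
  by_cases h0 : coeff m (v c) = 0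
  · simp [h0]
  · rw [if_pos (hv c m (mem_support_iff.2 h0))]

theorem exists_sum_vecComp {r : ℕ} (deg : Fin r → ℕ) (v : Fin r → MvPolynomial σ K) :
    ∃ M, v = ∑ k ∈ Finset.range M, vecComp deg k v := by
  refine ⟨(∑ c, ((v c).totalDegree + deg c)) + 1, ?_⟩
  funext c
  ext m
  rw [Finset.sum_apply, coeff_sum]
  simp only [vecComp, coeff_shiftComp]
  rw [Finset.sum_ite_eq]
  split_ifs with h
  · rfl
  · by_contra h0
    apply h
    have h1 := le_totalDegree (mem_support_iff.2 h0)
    have h2 := Finset.single_le_sum (f := fun c => (v c).totalDegree + deg c)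
      (fun _ _ => Nat.zero_le _) (Finset.mem_univ c)
    have h3 : m.degree = m.sum fun _ e => e := rfl
    rw [Finset.mem_range]
    omega

/-- Taking degree `k` parts commutes with a homogeneous map of graded free modules. -/
theorem vecComp_linearCombination {r s : ℕ} (deg : Fin r → ℕ) (deg' : Fin s → ℕ)
    (g : Fin s → Fin r → MvPolynomial σ K) (hg : ∀ b, IsHomogeneousVec deg (deg' b) (g b))
    (k : ℕ) (v : Fin s → MvPolynomial σ K) :
    vecComp deg k (Fintype.linearCombination (MvPolynomial σ K) g v) =
      Fintype.linearCombination (MvPolynomial σ K) g (vecComp deg' k v) := by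
  funext c
  simp only [vecComp, Fintype.linearCombination_apply, Finset.sum_apply, Pi.smul_apply,
    smul_eq_mul, shiftComp_sum]
  exact Finset.sum_congr rfl fun b _ => shiftComp_mul _ _ _ _ _ (hg b c)

/-- A submodule of `⨁_c S(-deg c)` is graded. -/
def IsGradedSubmodule {r : ℕ} (deg : Fin r → ℕ)
    (N : Submodule (MvPolynomial σ K) (Fin r → MvPolynomial σ K)) : Prop :=
  ∀ v ∈ N, ∀ k, vecComp deg k v ∈ N

theorem isGradedSubmodule_ker {r s : ℕ} {deg : Fin r → ℕ} {deg' : Fin s → ℕ}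
    {g : Fin s → Fin r → MvPolynomial σ K} (hg : ∀ b, IsHomogeneousVec deg (deg' b) (g b)) :
    IsGradedSubmodule deg' (LinearMap.ker (Fintype.linearCombination (MvPolynomial σ K) g)) := by
  intro v hv k
  rw [LinearMap.mem_ker] at hv ⊢
  rw [← vecComp_linearCombination deg deg' g hg, hv]
  funext c
  simp [vecComp, shiftComp]

theorem exists_generators [Finite σ] {r : ℕ} {deg : Fin r → ℕ}
    {N : Submodule (MvPolynomial σ K) (Fin r → MvPolynomial σ K)} (hN : IsGradedSubmodule deg N) :
    ∃ (s : ℕ) (deg' : Fin s → ℕ) (g : Fin s → Fin r → MvPolynomial σ K),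
      (∀ b, IsHomogeneousVec deg (deg' b) (g b)) ∧
      Submodule.span (MvPolynomial σ K) (Set.range g) = N := by
  obtain ⟨T, hT⟩ := (inferInstance : IsNoetherian (MvPolynomial σ K)
    (Fin r → MvPolynomial σ K)).noetherian N
  choose M hM using exists_sum_vecComp (σ := σ) (K := K) deg
  let e := Fintype.equivFin (Σ t : T, Fin (M t))
  refine ⟨_, fun b => (e.symm b).2, fun b => vecComp deg (e.symm b).2 (e.symm b).1,
    fun b => vecComp_isHomogeneousVec _ _ _, le_antisymm ?_ ?_⟩
  · rw [Submodule.span_le]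
    rintro _ ⟨b, rfl⟩
    exact hN _ (hT ▸ Submodule.subset_span (e.symm b).1.2) _
  · rw [← hT, Submodule.span_le]
    intro t ht
    rw [SetLike.mem_coe, hM t]
    refine Submodule.sum_mem _ fun k hk => Submodule.subset_span ?_
    exact ⟨e ⟨⟨t, ht⟩, ⟨k, Finset.mem_range.1 hk⟩⟩, by
      dsimp only
      rw [e.symm_apply_apply]⟩

theorem exists_minimal_generators [Finite σ] {r : ℕ} {deg : Fin r → ℕ}
    {N : Submodule (MvPolynomial σ K) (Fin r → MvPolynomial σ K)} (hN : IsGradedSubmodule deg N) :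
    ∃ (s : ℕ) (deg' : Fin s → ℕ) (g : Fin s → Fin r → MvPolynomial σ K),
      (∀ b, IsHomogeneousVec deg (deg' b) (g b)) ∧
      Submodule.span (MvPolynomial σ K) (Set.range g) = N ∧
      ∀ v, Fintype.linearCombination (MvPolynomial σ K) g v = 0 →
        ∀ b, constantCoeff (v b) = 0 := by
  classical
  have hex := exists_generators hN
  obtain ⟨deg', g, hg, hspan⟩ := Nat.find_spec hex
  refine ⟨_, deg', g, hg, hspan, fun v hv b₀ => ?_⟩
  by_contra hne
  -- the basis element `b₀` is superfluous
  set w := vecComp deg' (deg' b₀) v with hw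
  have hw0 : Fintype.linearCombination (MvPolynomial σ K) g w = 0 := by
    rw [hw, ← vecComp_linearCombination deg deg' g hg, hv]
    funext c
    simp [vecComp, shiftComp]
  have hwb : w b₀ = C (constantCoeff (v b₀)) := by
    rw [hw, vecComp, shiftComp, if_pos le_rfl, Nat.sub_self, homogeneousComponent_zero]
    rfl
  have hmem : g b₀ ∈ Submodule.span (MvPolynomial σ K) (g '' {b | b ≠ b₀}) := by
    rw [Fintype.linearCombination_apply, ← Finset.add_sum_erase _ _ (Finset.mem_univ b₀),
      hwb] at hw0
    have h1 : g b₀ = -(C (constantCoeff (v b₀))⁻¹ : MvPolynomial σ K) •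
        ∑ b ∈ Finset.univ.erase b₀, w b • g b := by
      rw [← neg_eq_of_add_eq_zero_right hw0, smul_neg, neg_smul, neg_neg, smul_smul, ← C_mul,
        inv_mul_cancel₀ hne, C_1, one_smul]
    rw [h1]
    refine Submodule.smul_mem _ _ (Submodule.sum_mem _ fun b hb => Submodule.smul_mem _ _
      (Submodule.subset_span ⟨b, ?_, rfl⟩))
    exact (Finset.mem_erase.1 hb).1
  have hspan' : Submodule.span (MvPolynomial σ K) (g '' {b | b ≠ b₀}) = N := by
    refine Eq.trans (le_antisymm (Submodule.span_mono (Set.image_subset_range _ _)) ?_) hspan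
    rw [Submodule.span_le]
    rintro _ ⟨b, rfl⟩
    by_cases hb : b = b₀
    · rw [hb]; exact hmem
    · exact Submodule.subset_span ⟨b, hb, rfl⟩
  let e := Fintype.equivFin {b // b ≠ b₀}
  have hcard : Fintype.card {b // b ≠ b₀} < Nat.find hex := by
    have := Fintype.card_subtype_lt (p := fun b => b ≠ b₀) (x := b₀) (by simp)
    simpa using this
  refine Nat.find_min hex hcard ⟨fun b => deg' (e.symm b), fun b => g (e.symm b),
    fun b => hg _, ?_⟩
  refine Eq.trans (congrArg _ ?_) hspan'
  ext x
  constructor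
  · rintro ⟨b, rfl⟩
    exact ⟨_, (e.symm b).2, rfl⟩
  · rintro ⟨b, hb, rfl⟩
    exact ⟨e ⟨b, hb⟩, by simp⟩

/-- A graded submodule of a graded free module; used to build a resolution step by step. -/
structure SyzygyStage (σ K : Type*) [Field K] where
  /-- the rank of the ambient free module -/
  r : ℕ
  /-- the degrees of its basis elements -/
  deg : Fin r → ℕ
  /-- the submodule -/
  N : Submodule (MvPolynomial σ K) (Fin r → MvPolynomial σ K)
  graded : IsGradedSubmodule deg N

/-- The next stage: the module of relations between minimal generators. -/
def SyzygyStage.next [Finite σ] (s : SyzygyStage σ K) : SyzygyStage σ K where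
  r := (exists_minimal_generators s.graded).choose
  deg := (exists_minimal_generators s.graded).choose_spec.choose
  N := LinearMap.ker (Fintype.linearCombination (MvPolynomial σ K)
    (exists_minimal_generators s.graded).choose_spec.choose_spec.choose)
  graded := isGradedSubmodule_ker
    (exists_minimal_generators s.graded).choose_spec.choose_spec.choose_spec.1

/-- The minimal generators of the submodule of a stage. -/
def SyzygyStage.gens [Finite σ] (s : SyzygyStage σ K) :
    Fin s.next.r → Fin s.r → MvPolynomial σ K :=
  (exists_minimal_generators s.graded).choose_spec.choose_spec.choose

/-- The map from the free module on minimal generators. -/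
def SyzygyStage.map [Finite σ] (s : SyzygyStage σ K) :
    (Fin s.next.r → MvPolynomial σ K) →ₗ[MvPolynomial σ K] (Fin s.r → MvPolynomial σ K) :=
  Fintype.linearCombination (MvPolynomial σ K) s.gens

theorem SyzygyStage.range_map [Finite σ] (s : SyzygyStage σ K) : LinearMap.range s.map = s.N := by
  rw [SyzygyStage.map, Fintype.range_linearCombination]
  exact (exists_minimal_generators s.graded).choose_spec.choose_spec.choose_spec.2.1

theorem SyzygyStage.map_homogeneous [Finite σ] (s : SyzygyStage σ K) (b : Fin s.next.r) :
    IsHomogeneousVec s.deg (s.next.deg b) (s.map (Pi.single b 1)) := by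
  have h : s.map (Pi.single b 1) = s.gens b := by
    classical
    rw [SyzygyStage.map]
    refine (Fintype.linearCombination_apply_single _ _ _ _).trans (one_smul _ _)
  rw [h]
  exact (exists_minimal_generators s.graded).choose_spec.choose_spec.choose_spec.1 b

theorem SyzygyStage.minimal [Finite σ] (s : SyzygyStage σ K)
    (v : Fin s.next.r → MvPolynomial σ K) (hv : v ∈ s.next.N) (b : Fin s.next.r) :
    constantCoeff (v b) = 0 :=
  (exists_minimal_generators s.graded).choose_spec.choose_spec.choose_spec.2.2 v hv b

/-- Every homogeneous ideal of a polynomial ring in finitely many variables over a field has a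
minimal graded free resolution. -/
theorem exists_isMinimal [Finite σ] {I : Ideal (MvPolynomial σ K)}
    (hI : I.IsHomogeneous (homogeneousSubmodule σ K)) :
    ∃ F : GradedFreeResolution I, F.IsMinimal := by
  let s₀ : SyzygyStage σ K :=
    { r := 1
      deg := fun _ => 0
      N := Submodule.comap (LinearMap.proj 0) I
      graded := by
        intro v hv k
        rw [Submodule.mem_comap] at hv ⊢
        simp only [LinearMap.proj_apply, vecComp, shiftComp] at hv ⊢
        rw [if_pos (Nat.zero_le k), Nat.sub_zero]
        exact homogeneousComponent_mem_of_mem hI hv k }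
  let s : ℕ → SyzygyStage σ K := fun i => Nat.rec s₀ (fun _ t => t.next) i
  refine ⟨{
    rank := fun i => (s (i + 1)).r
    deg := fun i => (s (i + 1)).deg
    aug := (LinearMap.proj (0 : Fin 1)).comp s₀.map
    d := fun i => (s (i + 1)).map
    aug_homogeneous := ?_
    d_homogeneous := fun i b => (s (i + 1)).map_homogeneous b
    range_aug := ?_
    exact_zero := ?_
    exact_succ := fun i => (s (i + 2)).range_map }, ?_⟩
  · intro b m hm
    have h := s₀.map_homogeneous b 0 m (mem_support_iff.2 hm)
    exact (DFunLike.congr_fun Finsupp.degree_eq_weight_one m).symm.trans h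
  · rw [LinearMap.range_comp, s₀.range_map]
    refine Submodule.map_comap_eq_of_surjective (fun a => ⟨fun _ => a, rfl⟩) I
  · refine ((s 1).range_map).trans ?_
    ext v
    change s₀.map v = 0 ↔ s₀.map v 0 = 0
    refine ⟨fun h => by rw [h]; rfl, fun h => ?_⟩
    funext c
    rw [Subsingleton.elim c 0]
    exact h
  · intro i v c
    refine (s i).minimal _ ?_ c
    exact (s (i + 1)).range_map ▸ LinearMap.mem_range_self _ v

end Existence

/-- The graded Betti number `β_{i,j}(I) = dim_K Tor_i(I, K)_j` of a homogeneous ideal `I` of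
`S = K[σ]`, regarded as a graded `S`-module (so `β_{0,j}(I)` counts minimal generators of degree
`j` and `β_{1,j}(I)` counts minimal first syzygies of degree `j`): the number of copies of `S(-j)`
in homological degree `i` of the minimal graded free resolution of `I`, which exists by
`exists_isMinimal` and is unique up to isomorphism. -/
def gradedBetti {σ K : Type*} [Field K] [Finite σ] (I : Ideal (MvPolynomial σ K))
    (hI : I.IsHomogeneous (homogeneousSubmodule σ K)) (i j : ℕ) : ℕ :=
  (exists_isMinimal hI).choose.multiplicity i j

end BinomialEdge
end

namespace BinomialEdge

variable {K : Type*} [Field K] {V σ : Type*}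

/-! The first syzygies of `J_G` in fact live in degree at most 4, whatever `n` is. The forest is
built edge by edge. An edge `e = {u, v}` of a forest is a bridge, so `u` and `v` lie in different
components of `H = G \ e`, and the colon ideal `J_H : f_e` is the binomial edge ideal of `H` with
the neighbourhoods of `u` and `v` completed (`mul_edgeBinomial_mem_iff`). It is therefore generated
by quadrics. In a syzygy of `J_G = J_H + (f_e)` the coefficient of `f_e` lies in this colon ideal. A
quadric `p` in it gives a quartic `p f_e` in `J_H`, hence a syzygy with quadric entries; subtracting
such syzygies leaves a syzygy of `J_H` (`HasQuadraticSyzygies.sup_span_singleton`). Vectors of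
quadrics thus generate all syzygies, and `deg_one_le_four` carries the resulting bound over to any
minimal resolution.

The colon ideal is computed by showing that `f_e` is a nonzerodivisor once the neighbourhoods of `u`
and `v` are cliques (`mem_of_mul_edgeBinomial_mem`). Any other vertex `w` with non-clique
neighbourhood is removed by the inclusion `J_{G_w} ∩ ((x_w, y_w) + J_{G \ w}) ⊆ J_G`. What remains
is a disjoint union of complete graphs, whose ideal is the kernel of a monomial map into a domain.
-/

/-- The binomial `x_i y_j - x_j y_i`. -/
noncomputable def edgeBinomial (K : Type*) [Field K] {V : Type*} (i j : V) :
    MvPolynomial (V ⊕ V) K :=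
  X (Sum.inl i) * X (Sum.inr j) - X (Sum.inl j) * X (Sum.inr i)

theorem edgeBinomial_isHomogeneous (i j : V) : (edgeBinomial K i j).IsHomogeneous 2 :=
  ((isHomogeneous_X K _).mul (isHomogeneous_X K _)).sub
    ((isHomogeneous_X K _).mul (isHomogeneous_X K _))

theorem edgeBinomial_mem {G : SimpleGraph V} {i j : V} (h : G.Adj i j) :
    edgeBinomial K i j ∈ binomialEdgeIdeal K G :=
  Ideal.subset_span ⟨i, j, h, rfl⟩

theorem binomialEdgeIdeal_le {G : SimpleGraph V} {I : Ideal (MvPolynomial (V ⊕ V) K)}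
    (h : ∀ i j, G.Adj i j → edgeBinomial K i j ∈ I) : binomialEdgeIdeal K G ≤ I := by
  refine Ideal.span_le.2 ?_
  rintro _ ⟨i, j, hij, rfl⟩
  exact h i j hij

theorem binomialEdgeIdeal_mono {G H : SimpleGraph V} (h : G ≤ H) :
    binomialEdgeIdeal K G ≤ binomialEdgeIdeal K H :=
  binomialEdgeIdeal_le fun _ _ hij => edgeBinomial_mem (h hij)

/-! ### Completing the neighbourhood of a vertex, and isolating a vertex -/

/-- The graph obtained by joining any two neighbours of `w`. -/
def completeNeighbors (G : SimpleGraph V) (w : V) : SimpleGraph V where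
  Adj i j := G.Adj i j ∨ (i ≠ j ∧ G.Adj w i ∧ G.Adj w j)
  symm := ⟨fun _ _ h => h.imp (fun h => h.symm) fun h => ⟨h.1.symm, h.2.2, h.2.1⟩⟩
  loopless := ⟨fun _ h => h.elim (fun h => h.ne rfl) fun h => h.1 rfl⟩

/-- The graph obtained by removing all edges at `w`. -/
def isolate (G : SimpleGraph V) (w : V) : SimpleGraph V where
  Adj i j := G.Adj i j ∧ i ≠ w ∧ j ≠ w
  symm := ⟨fun _ _ h => ⟨h.1.symm, h.2.2, h.2.1⟩⟩
  loopless := ⟨fun _ h => h.1.ne rfl⟩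

theorem le_completeNeighbors (G : SimpleGraph V) (w : V) : G ≤ completeNeighbors G w :=
  fun _ _ h => Or.inl h

theorem isolate_le (G : SimpleGraph V) (w : V) : isolate G w ≤ G :=
  fun _ _ h => h.1

theorem completeNeighbors_adj_self {G : SimpleGraph V} {w i : V} :
    (completeNeighbors G w).Adj w i ↔ G.Adj w i :=
  ⟨fun h => h.elim id fun h => h.2.2, Or.inl⟩

theorem isClique_completeNeighbors_self (G : SimpleGraph V) (w : V) :
    (completeNeighbors G w).IsClique ((completeNeighbors G w).neighborSet w) := by
  intro i hi j hj hij
  exact Or.inr ⟨hij, completeNeighbors_adj_self.1 hi, completeNeighbors_adj_self.1 hj⟩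

/-- If `v` is adjacent to `w`, every other neighbour of `v` is already adjacent to `w`, so all new
neighbours of `v` are joined to the old ones. Completing at `w` thus never spoils another vertex,
which makes the later induction terminate. -/
theorem isClique_completeNeighbors {G : SimpleGraph V} (w : V) {v : V}
    (h : G.IsClique (G.neighborSet v)) :
    (completeNeighbors G w).IsClique ((completeNeighbors G w).neighborSet v) := by
  have key : ∀ i, G.Adj w v → G.Adj v i → i = w ∨ G.Adj w i := fun i hw hi =>
    or_iff_not_imp_left.2 fun hne => (h hi hw.symm hne).symm
  rintro i hi j hj hij
  rcases hi with hi | ⟨-, hwv, hwi⟩ <;> rcases hj with hj | ⟨-, hwv', hwj⟩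
  · exact Or.inl (h hi hj hij)
  · rcases key i hwv' hi with rfl | h'
    · exact Or.inl hwj
    · exact Or.inr ⟨hij, h', hwj⟩
  · rcases key j hwv hj with rfl | h'
    · exact Or.inl hwi.symm
    · exact Or.inr ⟨hij, hwi, h'⟩
  · exact Or.inr ⟨hij, hwi, hwj⟩

theorem isClique_isolate_self (G : SimpleGraph V) (w : V) :
    (isolate G w).IsClique ((isolate G w).neighborSet w) :=
  fun _ hi => absurd rfl hi.2.1

theorem isClique_isolate {G : SimpleGraph V} (w : V) {v : V}
    (h : G.IsClique (G.neighborSet v)) :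
    (isolate G w).IsClique ((isolate G w).neighborSet v) :=
  fun _ hi _ hj hij => ⟨h hi.1 hj.1 hij, hi.2.2, hj.2.2⟩

/-- A new edge `i j` can be replaced by the path `i w j`, so completion does not merge components.
-/
theorem reachable_of_completeNeighbors {G : SimpleGraph V} {w u v : V}
    (h : (completeNeighbors G w).Reachable u v) : G.Reachable u v := by
  obtain ⟨p⟩ := h
  induction p with
  | nil => exact SimpleGraph.Reachable.refl _
  | cons h _ ih =>
    refine SimpleGraph.Reachable.trans ?_ ih
    rcases h with h | ⟨-, h1, h2⟩
    · exact h.reachable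
    · exact h1.symm.reachable.trans h2.reachable

/-! ### Decomposition of the binomial edge ideal at a vertex -/

/-- The substitution `x_w = y_w = 0`. -/
noncomputable def killVertex (K : Type*) [Field K] {V : Type*} (w : V) :
    MvPolynomial (V ⊕ V) K →ₐ[K] MvPolynomial (V ⊕ V) K :=
  open Classical in aeval fun s => if s = Sum.inl w ∨ s = Sum.inr w then 0 else X s

theorem killVertex_edgeBinomial_of_ne {w i j : V} (hi : i ≠ w) (hj : j ≠ w) :
    killVertex K w (edgeBinomial K i j) = edgeBinomial K i j := by
  simp [killVertex, edgeBinomial, hi, hj]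

theorem killVertex_edgeBinomial_left (w j : V) : killVertex K w (edgeBinomial K w j) = 0 := by
  simp [killVertex, edgeBinomial]

theorem killVertex_edgeBinomial_right (w i : V) : killVertex K w (edgeBinomial K i w) = 0 := by
  simp [killVertex, edgeBinomial]

theorem killVertex_mem {G : SimpleGraph V} (w : V) {p : MvPolynomial (V ⊕ V) K}
    (hp : p ∈ binomialEdgeIdeal K G) : killVertex K w p ∈ binomialEdgeIdeal K (isolate G w) := by
  refine (binomialEdgeIdeal_le (I := (binomialEdgeIdeal K (isolate G w)).comap
    (killVertex K w)) fun i j hij => ?_) hp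
  rw [Ideal.mem_comap]
  by_cases hi : i = w
  · rw [hi, killVertex_edgeBinomial_left]; exact zero_mem _
  by_cases hj : j = w
  · rw [hj, killVertex_edgeBinomial_right]; exact zero_mem _
  rw [killVertex_edgeBinomial_of_ne hi hj]
  exact edgeBinomial_mem ⟨hij, hi, hj⟩

/-- Plücker-type relation: `x_w f_{ij} = x_i f_{wj} - x_j f_{wi}`, with both binomials on the right
coming from edges at `w`. -/
theorem X_inl_mul_mem {G : SimpleGraph V} {w : V} {p : MvPolynomial (V ⊕ V) K}
    (hp : p ∈ binomialEdgeIdeal K (completeNeighbors G w)) :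
    X (Sum.inl w) * p ∈ binomialEdgeIdeal K G := by
  refine (binomialEdgeIdeal_le (I := Submodule.comap
    (LinearMap.mulLeft (MvPolynomial (V ⊕ V) K) (X (Sum.inl w))) (binomialEdgeIdeal K G)) ?_) hp
  rintro i j (hij | ⟨-, hi, hj⟩)
  · exact Ideal.mul_mem_left _ _ (edgeBinomial_mem hij)
  · have : X (Sum.inl w) * edgeBinomial K i j =
        X (Sum.inl i) * edgeBinomial K w j - X (Sum.inl j) * edgeBinomial K w i := by
      simp only [edgeBinomial]; ring
    change X (Sum.inl w) * edgeBinomial K i j ∈ binomialEdgeIdeal K G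
    rw [this]
    exact sub_mem (Ideal.mul_mem_left _ _ (edgeBinomial_mem hj))
      (Ideal.mul_mem_left _ _ (edgeBinomial_mem hi))

theorem X_inr_mul_mem {G : SimpleGraph V} {w : V} {p : MvPolynomial (V ⊕ V) K}
    (hp : p ∈ binomialEdgeIdeal K (completeNeighbors G w)) :
    X (Sum.inr w) * p ∈ binomialEdgeIdeal K G := by
  refine (binomialEdgeIdeal_le (I := Submodule.comap
    (LinearMap.mulLeft (MvPolynomial (V ⊕ V) K) (X (Sum.inr w))) (binomialEdgeIdeal K G)) ?_) hp
  rintro i j (hij | ⟨-, hi, hj⟩)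
  · exact Ideal.mul_mem_left _ _ (edgeBinomial_mem hij)
  · have : X (Sum.inr w) * edgeBinomial K i j =
        X (Sum.inr i) * edgeBinomial K w j - X (Sum.inr j) * edgeBinomial K w i := by
      simp only [edgeBinomial]; ring
    change X (Sum.inr w) * edgeBinomial K i j ∈ binomialEdgeIdeal K G
    rw [this]
    exact sub_mem (Ideal.mul_mem_left _ _ (edgeBinomial_mem hj))
      (Ideal.mul_mem_left _ _ (edgeBinomial_mem hi))

/-- The difference `r - killVertex K w r` lies in `(x_w, y_w)`, and both variables multiply the
larger ideal into `J_G`. -/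
theorem sub_killVertex_mul_mem {G : SimpleGraph V} {w : V} {p : MvPolynomial (V ⊕ V) K}
    (hp : p ∈ binomialEdgeIdeal K (completeNeighbors G w)) (r : MvPolynomial (V ⊕ V) K) :
    (r - killVertex K w r) * p ∈ binomialEdgeIdeal K G := by
  classical
  induction r using MvPolynomial.induction_on with
  | C a => simp [killVertex]
  | add r s hr hs =>
    have : (r + s - killVertex K w (r + s)) * p =
        (r - killVertex K w r) * p + (s - killVertex K w s) * p := by
      rw [map_add]; ring
    rw [this]
    exact add_mem hr hs
  | mul_X r s hr =>
    have : (r * X s - killVertex K w (r * X s)) * p =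
        X s * ((r - killVertex K w r) * p) +
          killVertex K w r * ((X s - killVertex K w (X s)) * p) := by
      rw [map_mul]; ring
    rw [this]
    refine add_mem (Ideal.mul_mem_left _ _ hr) (Ideal.mul_mem_left _ _ ?_)
    by_cases hs : s = Sum.inl w ∨ s = Sum.inr w
    · have h0 : killVertex K w (X s) = 0 := by simp [killVertex, hs]
      rw [h0, sub_zero]
      rcases hs with rfl | rfl
      · exact X_inl_mul_mem hp
      · exact X_inr_mul_mem hp
    · have h0 : killVertex K w (X s) = X s := by simp [killVertex, hs]
      simp [h0]

/-- The added generators do not involve `w` and are fixed by the substitution; the old ones already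
lie in `J_G`, as do their images. -/
theorem sub_killVertex_mem {G : SimpleGraph V} {w : V} {p : MvPolynomial (V ⊕ V) K}
    (hp : p ∈ binomialEdgeIdeal K (completeNeighbors G w)) :
    p - killVertex K w p ∈ binomialEdgeIdeal K G := by
  induction hp using Submodule.span_induction with
  | mem q hq =>
    obtain ⟨i, j, hij, rfl⟩ := hq
    change edgeBinomial K i j - killVertex K w (edgeBinomial K i j) ∈ _
    rcases hij with hij | ⟨-, hi, hj⟩
    · exact sub_mem (edgeBinomial_mem hij)
        (binomialEdgeIdeal_mono (isolate_le G w) (killVertex_mem w (edgeBinomial_mem hij)))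
    · rw [killVertex_edgeBinomial_of_ne hi.ne' hj.ne', sub_self]
      exact zero_mem _
  | zero => simp
  | add q r _ _ hq hr =>
    rw [map_add, add_sub_add_comm]
    exact add_mem hq hr
  | smul a q hq ih =>
    have : a • q - killVertex K w (a • q) =
        (a - killVertex K w a) * q + killVertex K w a * (q - killVertex K w q) := by
      rw [smul_eq_mul, map_mul]; ring
    rw [this]
    exact add_mem (sub_killVertex_mul_mem hq a) (Ideal.mul_mem_left _ _ ih)

/-- The inclusion `J_{G_w} ∩ ((x_w, y_w) + J_{G \ w}) ⊆ J_G`. -/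
theorem mem_of_mem_completeNeighbors_of_killVertex_mem {G : SimpleGraph V} {w : V}
    {p : MvPolynomial (V ⊕ V) K} (h1 : p ∈ binomialEdgeIdeal K (completeNeighbors G w))
    (h2 : killVertex K w p ∈ binomialEdgeIdeal K (isolate G w)) :
    p ∈ binomialEdgeIdeal K G := by
  have := add_mem (sub_killVertex_mem h1) (binomialEdgeIdeal_mono (isolate_le G w) h2)
  rwa [sub_add_cancel] at this

/-! ### Disjoint unions of complete graphs -/

section Toric

variable {Q : Type*} (c : V → Q)

/-- The exponents of the monomials `a_{c i} t_i` and `b_{c i} t_i`. -/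
noncomputable def toricExponent : V ⊕ V → ((Q ⊕ Q) ⊕ V →₀ ℕ)
  | Sum.inl i => Finsupp.single (Sum.inl (Sum.inl (c i))) 1 + Finsupp.single (Sum.inr i) 1
  | Sum.inr i => Finsupp.single (Sum.inl (Sum.inr (c i))) 1 + Finsupp.single (Sum.inr i) 1

/-- The map of exponents induced by `toricMap`. -/
noncomputable def toricExponentMap : (V ⊕ V →₀ ℕ) →ₗ[ℕ] ((Q ⊕ Q) ⊕ V →₀ ℕ) :=
  Finsupp.linearCombination ℕ (toricExponent c)

/-- The homomorphism `x_i ↦ a_{c i} t_i`, `y_i ↦ b_{c i} t_i`. -/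
noncomputable def toricMap (K : Type*) [Field K] :
    MvPolynomial (V ⊕ V) K →ₐ[K] MvPolynomial ((Q ⊕ Q) ⊕ V) K :=
  aeval fun s => monomial (toricExponent c s) 1

theorem toricMap_monomial (m : V ⊕ V →₀ ℕ) (a : K) :
    toricMap c K (monomial m a) = monomial (toricExponentMap c m) a := by
  rw [toricMap, aeval_monomial, toricExponentMap, Finsupp.linearCombination_apply,
    monomial_finsupp_sum_index, algebraMap_eq]
  simp only [monomial_pow, one_pow]

theorem toricExponentMap_inr [Fintype V] (m : V ⊕ V →₀ ℕ) (i : V) :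
    toricExponentMap c m (Sum.inr i) = m (Sum.inl i) + m (Sum.inr i) := by
  classical
  simp [toricExponentMap, Finsupp.linearCombination_apply, Finsupp.sum_fintype,
    toricExponent,
    Finsupp.single_apply]

theorem toricExponentMap_inl [Fintype V] [DecidableEq Q] (m : V ⊕ V →₀ ℕ) (q : Q) :
    toricExponentMap c m (Sum.inl (Sum.inl q)) = ∑ i with c i = q, m (Sum.inl i) := by
  classical
  simp [toricExponentMap, Finsupp.linearCombination_apply, Finsupp.sum_fintype,
    toricExponent,
    Finsupp.single_apply, Finset.sum_filter]

/-- Exchange argument: replacing `x_i y_j` by `x_j y_i` inside a fibre of `c` changes a monomial by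
a multiple of an edge binomial, and such exchanges connect any two monomials with the same image. -/
theorem monomial_sub_mem [Fintype V] {G : SimpleGraph V}
    (hG : ∀ i j, i ≠ j → c i = c j → G.Adj i j) (a : K) (m m' : V ⊕ V →₀ ℕ)
    (h : toricExponentMap c m = toricExponentMap c m') :
    monomial m a - monomial m' a ∈ binomialEdgeIdeal K G := by
  classical
  -- The measure is the total excess of the `x`-exponents of `m` over those of `m'`; truncated
  -- subtraction ignores deficits.
  induction hN : ∑ i, (m (Sum.inl i) - m' (Sum.inl i)) using Nat.strong_induction_on
    generalizing m with
  | _ N ih =>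
  have hr : ∀ i, m (Sum.inl i) + m (Sum.inr i) = m' (Sum.inl i) + m' (Sum.inr i) := fun i => by
    rw [← toricExponentMap_inr c, h, toricExponentMap_inr]
  have hl : ∀ q, ∑ i with c i = q, m (Sum.inl i) = ∑ i with c i = q, m' (Sum.inl i) := fun q => by
    rw [← toricExponentMap_inl c, h, toricExponentMap_inl]
  by_cases hle : ∃ i, m' (Sum.inl i) < m (Sum.inl i)
  · obtain ⟨i, hi⟩ := hle
    -- The `x`-degrees agree on the fibre, so the excess at `i` forces a deficit at some `j`;
    -- equality of the `t_j`-degrees then makes `y_j` divide the monomial.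
    obtain ⟨j, hcj, hj⟩ : ∃ j, c i = c j ∧ m (Sum.inl j) < m' (Sum.inl j) := by
      by_contra! hcon
      refine (hl (c i)).not_gt (Finset.sum_lt_sum (fun j hj => ?_) ⟨i, by simp, hi⟩)
      exact hcon j (Finset.mem_filter.1 hj).2.symm
    have hij : i ≠ j := by rintro rfl; omega
    have hrj := hr j
    set e : V ⊕ V →₀ ℕ := Finsupp.single (Sum.inl i) 1 + Finsupp.single (Sum.inr j) 1 with he
    set e' : V ⊕ V →₀ ℕ := Finsupp.single (Sum.inl j) 1 + Finsupp.single (Sum.inr i) 1 with he'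
    obtain ⟨r, rfl⟩ : ∃ r, m = r + e := by
      refine ⟨m - e, (tsub_add_cancel_of_le ?_).symm⟩
      intro s
      rcases s with s | s
      · by_cases hs : i = s
        · subst hs; simp [he]; omega
        · simp [he, hs]
      · by_cases hs : j = s
        · subst hs; simp [he]; omega
        · simp [he, hs]
    have hLe : toricExponentMap c e = toricExponentMap c e' := by
      simp only [he, he', toricExponentMap, map_add, Finsupp.linearCombination_single, one_smul,
        toricExponent, hcj]
      ac_rfl
    have hdiff : monomial (r + e) a - monomial (r + e') a =
        monomial r a * edgeBinomial K i j := by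
      simp only [edgeBinomial, mul_sub, X, monomial_mul, he, he', mul_one]
    have hmem : monomial (r + e') a - monomial m' a ∈ binomialEdgeIdeal K G := by
      refine ih _ ?_ _ (by rw [← h, (toricExponentMap c).map_add r e, hLe, ← map_add]) rfl
      rw [← hN]
      have hi' : (r + e') (Sum.inl i) = r (Sum.inl i) := by simp [he', hij.symm]
      have hi1 : (r + e) (Sum.inl i) = r (Sum.inl i) + 1 := by simp [he]
      have hj' : (r + e') (Sum.inl j) = r (Sum.inl j) + 1 := by simp [he']
      have hj1 : (r + e) (Sum.inl j) = r (Sum.inl j) := by simp [he, hij]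
      refine Finset.sum_lt_sum (fun k _ => ?_) ⟨i, Finset.mem_univ i, by omega⟩
      by_cases hkj : k = j
      · subst hkj; omega
      · have h1 : (r + e') (Sum.inl k) = r (Sum.inl k) := by
          simp [he', Ne.symm hkj]
        have h2 : r (Sum.inl k) ≤ (r + e) (Sum.inl k) := by simp
        omega
    rw [← sub_add_sub_cancel _ (monomial (r + e') a), hdiff]
    exact add_mem (Ideal.mul_mem_left _ _ (edgeBinomial_mem (hG i j hij hcj))) hmem
  · push Not at hle
    have heq : ∀ i, m (Sum.inl i) = m' (Sum.inl i) := fun i =>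
      (Finset.sum_eq_sum_iff_of_le fun j _ => hle j).1 (hl (c i)) i (by simp)
    have : m = m' := by
      ext s
      rcases s with s | s
      · exact heq s
      · have := heq s
        have := hr s
        omega
    rw [this, sub_self]
    exact zero_mem _

/-- The kernel of `toricMap` lies in the binomial edge ideal of the disjoint union of the
complete graphs on the fibres of `c`. -/
theorem mem_of_toricMap_eq_zero [Fintype V] {G : SimpleGraph V}
    (hG : ∀ i j, i ≠ j → c i = c j → G.Adj i j) {p : MvPolynomial (V ⊕ V) K}
    (hp : toricMap c K p = 0) : p ∈ binomialEdgeIdeal K G := by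
  -- A linear map choosing one preimage for each monomial in the image. The arbitrary values of
  -- `Function.invFun` off the range are never used.
  let σ : MvPolynomial ((Q ⊕ Q) ⊕ V) K →ₗ[K] MvPolynomial (V ⊕ V) K :=
    (basisMonomials _ K).constr K fun m => monomial (Function.invFun (toricExponentMap c) m) 1
  have hσ : ∀ m a, σ (monomial m a) = monomial (Function.invFun (toricExponentMap c) m) a := by
    intro m a
    have h1 : monomial m a = a • basisMonomials ((Q ⊕ Q) ⊕ V) K m := by
      rw [coe_basisMonomials, smul_monomial, smul_eq_mul, mul_one]
    rw [h1, map_smul, Module.Basis.constr_basis, smul_monomial, smul_eq_mul, mul_one]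
  have key : ∀ q : MvPolynomial (V ⊕ V) K, q - σ (toricMap c K q) ∈ binomialEdgeIdeal K G := by
    intro q
    induction q using MvPolynomial.induction_on' with
    | monomial m a =>
      rw [toricMap_monomial, hσ]
      exact monomial_sub_mem c hG a _ _ (Function.invFun_eq ⟨m, rfl⟩).symm
    | add q r hq hr =>
      rw [map_add, map_add, add_sub_add_comm]
      exact add_mem hq hr
  simpa [hp] using key p

theorem toricMap_eq_zero {G : SimpleGraph V} (hG : ∀ i j, G.Adj i j → c i = c j)
    {p : MvPolynomial (V ⊕ V) K} (hp : p ∈ binomialEdgeIdeal K G) : toricMap c K p = 0 := by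
  refine (binomialEdgeIdeal_le (I := RingHom.ker (toricMap c K)) fun i j hij => ?_) hp
  rw [RingHom.mem_ker]
  simp only [edgeBinomial, toricMap, map_sub, map_mul, aeval_X, monomial_mul, toricExponent,
    hG i j hij]
  rw [sub_eq_zero]
  congr 1
  ac_rfl

/-- The variable `a_{c i}` occurs in the image of only one of the two terms. -/
theorem toricMap_edgeBinomial_ne_zero {i j : V} (h : c i ≠ c j) :
    toricMap c K (edgeBinomial K i j) ≠ 0 := by
  classical
  simp only [edgeBinomial, toricMap, map_sub, map_mul, aeval_X, monomial_mul, toricExponent]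
  rw [sub_ne_zero]
  intro heq
  rw [monomial_left_inj (by simp)] at heq
  have := DFunLike.congr_fun heq (Sum.inl (Sum.inl (c i)))
  simp [h.symm] at this

end Toric

/-! ### Edge binomials between components as nonzerodivisors -/

/-- If all neighbourhoods are cliques, then reachable vertices are adjacent or equal. -/
theorem eq_or_adj_of_reachable {G : SimpleGraph V}
    (hG : ∀ v, G.IsClique (G.neighborSet v)) {i j : V} (h : G.Reachable i j) :
    i = j ∨ G.Adj i j := by
  obtain ⟨p⟩ := h
  induction p with
  | nil => exact Or.inl rfl
  | @cons u v w huv _ ih =>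
    rcases ih with rfl | h
    · exact Or.inr huv
    · exact or_iff_not_imp_left.2 fun hne => hG v huv.symm h hne

/-- If the neighbourhoods of `u` and `v` are cliques and `u` and `v` lie in different components,
then `x_u y_v - x_v y_u` is a nonzerodivisor modulo the binomial edge ideal. -/
theorem mem_of_mul_edgeBinomial_mem [Fintype V] {G : SimpleGraph V} {u v : V}
    (hu : G.IsClique (G.neighborSet u)) (hv : G.IsClique (G.neighborSet v))
    (huv : ¬ G.Reachable u v) {p : MvPolynomial (V ⊕ V) K}
    (hp : p * edgeBinomial K u v ∈ binomialEdgeIdeal K G) : p ∈ binomialEdgeIdeal K G := by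
  classical
  -- Both completing at and isolating a non-clique vertex lower this count.
  induction hN : (Finset.univ.filter fun v => ¬ G.IsClique (G.neighborSet v)).card
    using Nat.strong_induction_on generalizing G p with
  | _ N ih =>
  by_cases hall : ∀ v, G.IsClique (G.neighborSet v)
  · have h0 := toricMap_eq_zero (K := K) G.connectedComponentMk
      (fun i j hij => SimpleGraph.ConnectedComponent.sound hij.reachable) hp
    rw [map_mul] at h0
    refine mem_of_toricMap_eq_zero G.connectedComponentMk (fun i j hij h => ?_)
      ((mul_eq_zero.1 h0).resolve_right (toricMap_edgeBinomial_ne_zero _ fun h =>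
        huv (SimpleGraph.ConnectedComponent.exact h)))
    exact (eq_or_adj_of_reachable hall (SimpleGraph.ConnectedComponent.exact h)).resolve_left hij
  · push Not at hall
    obtain ⟨w, hw⟩ := hall
    have hlt : ∀ H : SimpleGraph V, H.IsClique (H.neighborSet w) →
        (∀ v, G.IsClique (G.neighborSet v) → H.IsClique (H.neighborSet v)) →
        (Finset.univ.filter fun v => ¬ H.IsClique (H.neighborSet v)).card < N := by
      intro H hHw hH
      rw [← hN]
      refine Finset.card_lt_card (Finset.ssubset_iff_of_subset ?_ |>.2 ⟨w, by simpa using hw,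
        by simpa using hHw⟩)
      intro v hv
      simp only [Finset.mem_filter, Finset.mem_univ, true_and] at hv ⊢
      exact fun h => hv (hH v h)
    refine mem_of_mem_completeNeighbors_of_killVertex_mem (w := w) ?_ ?_
    · exact ih _ (hlt _ (isClique_completeNeighbors_self G w)
        fun v => isClique_completeNeighbors w) (isClique_completeNeighbors w hu)
        (isClique_completeNeighbors w hv) (fun h => huv (reachable_of_completeNeighbors h))
        (binomialEdgeIdeal_mono (le_completeNeighbors G w) hp) rfl
    · refine ih _ (hlt _ (isClique_isolate_self G w) fun v => isClique_isolate w)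
        (isClique_isolate w hu) (isClique_isolate w hv)
        (fun h => huv (h.mono (isolate_le G w))) ?_ rfl
      -- Hence `w` is neither `u` nor `v`, and setting `x_w = y_w = 0` leaves the binomial of `u`
      -- and `v` unchanged.
      have hne : ∀ {x}, G.IsClique (G.neighborSet x) → x ≠ w := by
        rintro _ hx rfl
        exact hw hx
      have := killVertex_mem w hp
      rwa [map_mul, killVertex_edgeBinomial_of_ne (hne hu) (hne hv)] at this

/-! ### Ideals generated by quadrics whose syzygies are generated by vectors of quadrics -/

/-- The syzygies of `f` all of whose coordinates are quadrics. -/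
def quadraticSyzygies {m : ℕ} (f : Fin m → MvPolynomial σ K) :
    Set (Fin m → MvPolynomial σ K) :=
  {d | (∀ k, (d k).IsHomogeneous 2) ∧ ∑ k, d k * f k = 0}

/-- The ideal `I` has a finite generating family of quadrics whose syzygies are generated by
vectors of quadrics. -/
def HasQuadraticSyzygies (I : Ideal (MvPolynomial σ K)) : Prop :=
  ∃ (m : ℕ) (f : Fin m → MvPolynomial σ K), (∀ k, (f k).IsHomogeneous 2) ∧
    Ideal.span (Set.range f) = I ∧
    ∀ c : Fin m → MvPolynomial σ K, ∑ k, c k * f k = 0 →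
      c ∈ Submodule.span (MvPolynomial σ K) (quadraticSyzygies f)

theorem hasQuadraticSyzygies_bot : HasQuadraticSyzygies (⊥ : Ideal (MvPolynomial σ K)) := by
  refine ⟨0, Fin.elim0, fun k => k.elim0, by simp, fun c _ => ?_⟩
  rw [Subsingleton.elim c 0]
  exact zero_mem _

/-- A homogeneous element of the ideal generated by quadrics has homogeneous coefficients. -/
theorem exists_isHomogeneous_coeff {m e : ℕ} {f : Fin m → MvPolynomial σ K}
    (hf : ∀ k, (f k).IsHomogeneous 2) {p : MvPolynomial σ K} (hp : p.IsHomogeneous (e + 2))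
    (hmem : p ∈ Ideal.span (Set.range f)) :
    ∃ d : Fin m → MvPolynomial σ K, (∀ k, (d k).IsHomogeneous e) ∧ ∑ k, d k * f k = p := by
  obtain ⟨c, rfl⟩ := (Ideal.mem_span_range_iff_exists_fun).1 hmem
  refine ⟨fun k => homogeneousComponent e (c k),
    fun k => homogeneousComponent_isHomogeneous _ _, ?_⟩
  have hdeg : ∀ {q : MvPolynomial σ K} {n : ℕ}, q.IsHomogeneous n →
      ∀ x ∈ q.support, x.degree + 0 = n := fun hq x hx => by
    rw [add_zero, Finsupp.degree_eq_weight_one]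
    exact hq (mem_support_iff.1 hx)
  have h2 : ∀ k, shiftComp 0 (e + 2) (c k * f k) = homogeneousComponent e (c k) * f k := by
    intro k
    rw [shiftComp_mul 0 2 (e + 2) (c k) (f k) (hdeg (hf k)), shiftComp, if_pos (by omega),
      Nat.add_sub_cancel]
  have h3 := shiftComp_sum 0 (e + 2) Finset.univ fun k => c k * f k
  simp only [h2] at h3
  rw [← h3, shiftComp, if_pos (Nat.zero_le _), Nat.sub_zero, homogeneousComponent_of_mem hp,
    if_pos rfl]

/-- The syzygies of the enlarged family form an extension of the colon ideal `I : q` (the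
coefficients of `q`) by the syzygies of the old family; `Q` generates that colon ideal. -/
theorem HasQuadraticSyzygies.sup_span_singleton {I : Ideal (MvPolynomial σ K)}
    (hI : HasQuadraticSyzygies I) {q : MvPolynomial σ K} (hq : q.IsHomogeneous 2)
    {Q : Set (MvPolynomial σ K)} (hQ : ∀ p ∈ Q, p.IsHomogeneous 2) (hQI : ∀ p ∈ Q, p * q ∈ I)
    (hcolon : ∀ p, p * q ∈ I → p ∈ Ideal.span Q) :
    HasQuadraticSyzygies (I ⊔ Ideal.span {q}) := by
  obtain ⟨m, f, hf, rfl, hsyz⟩ := hI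
  refine ⟨m + 1, Fin.cons q f, Fin.cases hq hf, ?_, fun c hc => ?_⟩
  · rw [Fin.range_cons, Ideal.span_insert, sup_comm]
  · set N := Submodule.span (MvPolynomial σ K)
      (quadraticSyzygies (Fin.cons q f : Fin (m + 1) → MvPolynomial σ K)) with hN
    rw [Fin.sum_univ_succ] at hc
    simp only [Fin.cons_zero, Fin.cons_succ] at hc
    have hker : ∀ d ∈ N, d 0 * q + ∑ k : Fin m, d k.succ * f k = 0 := by
      intro d hd
      induction hd using Submodule.span_induction with
      | mem d hd => simpa [Fin.sum_univ_succ] using hd.2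
      | zero => simp
      | add a b _ _ ha hb =>
        simp only [Pi.add_apply, add_mul, Finset.sum_add_distrib]
        linear_combination ha + hb
      | smul r a _ ha =>
        simp only [Pi.smul_apply, smul_eq_mul, mul_assoc, ← Finset.mul_sum]
        linear_combination r * ha
    have hfirst : c 0 ∈ Ideal.span Q := by
      refine hcolon _ ?_
      rw [eq_neg_of_add_eq_zero_left hc]
      exact neg_mem (Ideal.sum_mem _ fun k _ =>
        Ideal.mul_mem_left _ _ (Ideal.subset_span ⟨k, rfl⟩))
    -- For `p ∈ Q` the product `p * q` is a quartic in `I`, so it has quadric coefficients with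
    -- respect to `f`.
    have hle : Ideal.span Q ≤ Submodule.map (LinearMap.proj (0 : Fin (m + 1))) N := by
      refine Ideal.span_le.2 fun p hp => ?_
      obtain ⟨d, hd, hdp⟩ := exists_isHomogeneous_coeff hf ((hQ p hp).mul hq) (hQI p hp)
      refine ⟨Fin.cons p (-d), Submodule.subset_span ⟨?_, ?_⟩, rfl⟩
      · exact Fin.cases (hQ p hp) fun k => (hd k).neg
      · simp [Fin.sum_univ_succ, hdp]
    obtain ⟨d, hd, hd0⟩ := hle hfirst
    have hd0' : d 0 = c 0 := hd0
    have htail : (fun k : Fin m => c k.succ - d k.succ) ∈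
        Submodule.span (MvPolynomial σ K) (quadraticSyzygies f) := by
      refine hsyz _ ?_
      have := hker d hd
      rw [hd0'] at this
      simp only [sub_mul, Finset.sum_sub_distrib]
      linear_combination hc - this
    let ι : (Fin m → MvPolynomial σ K) →ₗ[MvPolynomial σ K] (Fin (m + 1) → MvPolynomial σ K) :=
      LinearMap.pi (Fin.cases 0 fun k => LinearMap.proj k)
    have hι : ∀ a, ι a = Fin.cons 0 a := fun a => by
      funext k
      refine Fin.cases rfl (fun k => rfl) k
    have hmem : Fin.cons 0 (fun k : Fin m => c k.succ - d k.succ) ∈ N := by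
      rw [← hι]
      refine (Submodule.span_le (p := N.comap ι)).2 (fun a ha => ?_) htail
      change ι a ∈ N
      rw [hι]
      refine Submodule.subset_span ⟨Fin.cases (isHomogeneous_zero _ _ _) ha.1, ?_⟩
      simpa [Fin.sum_univ_succ] using ha.2
    have : c = Fin.cons 0 (fun k : Fin m => c k.succ - d k.succ) + d := by
      funext k
      refine Fin.cases ?_ (fun k => ?_) k
      · simp [hd0']
      · simp
    rw [this]
    exact add_mem hmem hd

/-! ### Colon ideals of bridges and the induction on edges -/

theorem mul_edgeBinomial_mem {G : SimpleGraph V} {u : V} (v : V) {p : MvPolynomial (V ⊕ V) K}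
    (h : p ∈ binomialEdgeIdeal K (completeNeighbors G u)) :
    p * edgeBinomial K u v ∈ binomialEdgeIdeal K G := by
  have : p * edgeBinomial K u v =
      X (Sum.inr v) * (X (Sum.inl u) * p) - X (Sum.inl v) * (X (Sum.inr u) * p) := by
    simp only [edgeBinomial]; ring
  rw [this]
  exact sub_mem (Ideal.mul_mem_left _ _ (X_inl_mul_mem h))
    (Ideal.mul_mem_left _ _ (X_inr_mul_mem h))

theorem edgeBinomial_swap (i j : V) : edgeBinomial K i j = -edgeBinomial K j i := by
  simp only [edgeBinomial]; ring

/-- The colon ideal `J_{G \ e} : f_e` of a bridge `e = {u, v}`. -/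
theorem mul_edgeBinomial_mem_iff [Fintype V] {G : SimpleGraph V} {u v : V}
    (huv : ¬ G.Reachable u v) {p : MvPolynomial (V ⊕ V) K} :
    p * edgeBinomial K u v ∈ binomialEdgeIdeal K G ↔
      p ∈ binomialEdgeIdeal K (completeNeighbors (completeNeighbors G u) v) := by
  constructor
  · intro h
    refine mem_of_mul_edgeBinomial_mem
      (isClique_completeNeighbors v (isClique_completeNeighbors_self G u))
      (isClique_completeNeighbors_self _ v)
      (fun hr => huv (reachable_of_completeNeighbors (reachable_of_completeNeighbors hr)))
      (binomialEdgeIdeal_mono ((le_completeNeighbors G u).trans (le_completeNeighbors _ v)) h)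
  · intro h
    -- A new edge at `v` would require `u` and `v` to be adjacent, so the two completions do not
    -- interact.
    have hle : ∀ i, (completeNeighbors G u).Adj v i → G.Adj v i := by
      rintro i (h | ⟨-, h, -⟩)
      · exact h
      · exact absurd h.reachable huv
    have hmul : ∀ i j, (completeNeighbors (completeNeighbors G u) v).Adj i j →
        edgeBinomial K i j * edgeBinomial K u v ∈ binomialEdgeIdeal K G := by
      rintro i j (hij | ⟨hij, hi, hj⟩)
      · exact mul_edgeBinomial_mem v (edgeBinomial_mem hij)
      · rw [edgeBinomial_swap u v, mul_neg]
        exact neg_mem (mul_edgeBinomial_mem u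
          (edgeBinomial_mem (Or.inr ⟨hij, hle i hi, hle j hj⟩)))
    exact (binomialEdgeIdeal_le (I := Submodule.comap (LinearMap.mulRight (MvPolynomial (V ⊕ V) K)
      (edgeBinomial K u v)) (binomialEdgeIdeal K G)) hmul) h

/-- The binomial edge ideal of a forest is generated by quadrics whose syzygies are generated by
vectors of quadrics. -/
theorem hasQuadraticSyzygies_of_isAcyclic [Fintype V] (G : SimpleGraph V) (hG : G.IsAcyclic) :
    HasQuadraticSyzygies (binomialEdgeIdeal K G) := by
  induction G using WellFoundedLT.induction with
  | _ G ih =>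
  by_cases hbot : G = ⊥
  · have : binomialEdgeIdeal K G = ⊥ :=
      le_bot_iff.1 (binomialEdgeIdeal_le fun i j hij => by simp [hbot] at hij)
    rw [this]
    exact hasQuadraticSyzygies_bot
  · obtain ⟨u, v, huv⟩ := SimpleGraph.ne_bot_iff_exists_adj.1 hbot
    set H := G.deleteEdges {s(u, v)} with hH
    have hle : H ≤ G := SimpleGraph.deleteEdges_le _
    have hlt : H < G := lt_of_le_of_ne hle fun h => by
      have : H.Adj u v := h ▸ huv
      simp [hH] at this
    have hnr : ¬ H.Reachable u v :=
      SimpleGraph.isBridge_iff.1 (SimpleGraph.isAcyclic_iff_forall_adj_isBridge.1 hG huv)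
    have hJ : binomialEdgeIdeal K G = binomialEdgeIdeal K H ⊔ Ideal.span {edgeBinomial K u v} := by
      refine le_antisymm (binomialEdgeIdeal_le fun i j hij => ?_) (sup_le
        (binomialEdgeIdeal_mono hle) ?_)
      · by_cases he : s(i, j) = s(u, v)
        · have hmem : edgeBinomial K u v ∈
              binomialEdgeIdeal K H ⊔ Ideal.span {edgeBinomial K u v} :=
            Ideal.mem_sup_right (Ideal.mem_span_singleton_self _)
          rcases Sym2.eq_iff.1 he with ⟨rfl, rfl⟩ | ⟨rfl, rfl⟩
          · exact hmem
          · exact edgeBinomial_swap (K := K) i j ▸ neg_mem hmem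
        · refine Ideal.mem_sup_left (edgeBinomial_mem ?_)
          rw [hH, SimpleGraph.deleteEdges_adj]
          exact ⟨hij, he⟩
      · rw [Ideal.span_singleton_le_iff_mem]
        exact edgeBinomial_mem huv
    rw [hJ]
    refine (ih H hlt (hG.anti hle)).sup_span_singleton (edgeBinomial_isHomogeneous u v)
      (Q := {f | ∃ i j : V, (completeNeighbors (completeNeighbors H u) v).Adj i j ∧
        f = X (Sum.inl i) * X (Sum.inr j) - X (Sum.inl j) * X (Sum.inr i)}) ?_ ?_ ?_
    · rintro _ ⟨i, j, -, rfl⟩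
      exact edgeBinomial_isHomogeneous i j
    · intro p hp
      exact (mul_edgeBinomial_mem_iff hnr).2 (Ideal.subset_span hp)
    · intro p hp
      exact (mul_edgeBinomial_mem_iff hnr).1 hp

/-! ### Degrees in a minimal resolution -/

theorem isHomogeneousVec_sum {r k : ℕ} {deg : Fin r → ℕ} {ι : Type*} (s : Finset ι)
    {v : ι → Fin r → MvPolynomial σ K} (hv : ∀ i ∈ s, IsHomogeneousVec deg k (v i)) :
    IsHomogeneousVec deg k (∑ i ∈ s, v i) := by
  intro c m hm
  rw [Finset.sum_apply, mem_support_iff, coeff_sum] at hm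
  obtain ⟨i, hi, hne⟩ := Finset.exists_ne_zero_of_sum_ne_zero hm
  exact hv i hi c m (mem_support_iff.2 hne)

theorem IsHomogeneousVec.smul {r k e : ℕ} {deg : Fin r → ℕ} {v : Fin r → MvPolynomial σ K}
    (hv : IsHomogeneousVec deg k v) {a : MvPolynomial σ K} (ha : a.IsHomogeneous e) :
    IsHomogeneousVec deg (e + k) (a • v) := by
  classical
  intro c m hm
  obtain ⟨x, hx, y, hy, rfl⟩ := Finset.mem_add.1 (support_mul a (v c) hm)
  have h1 := hv c y hy
  have h2 : x.degree = e := by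
    rw [Finsupp.degree_eq_weight_one]
    exact ha (mem_support_iff.1 hx)
  rw [map_add, h2, ← h1, add_assoc]

theorem IsHomogeneousVec.sub {r k : ℕ} {deg : Fin r → ℕ} {v w : Fin r → MvPolynomial σ K}
    (hv : IsHomogeneousVec deg k v) (hw : IsHomogeneousVec deg k w) :
    IsHomogeneousVec deg k (v - w) := by
  classical
  intro c m hm
  exact (Finset.mem_union.1 (support_sub σ (v c) (w c) hm)).elim (hv c m) (hw c m)

theorem isHomogeneousVec_single {r : ℕ} (deg : Fin r → ℕ) (b : Fin r) :
    IsHomogeneousVec deg (deg b) (Pi.single b (1 : MvPolynomial σ K)) := by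
  classical
  intro c m hm
  by_cases h : c = b
  · subst h
    rw [Pi.single_eq_same, mem_support_iff, coeff_one] at hm
    have : m = 0 := by by_contra h; exact hm (if_neg (Ne.symm h))
    simp [this]
  · simp [Pi.single_eq_of_ne h] at hm

theorem IsHomogeneousVec.constantCoeff_eq_zero {r k : ℕ} {deg : Fin r → ℕ}
    {v : Fin r → MvPolynomial σ K} (hv : IsHomogeneousVec deg k v) {b : Fin r}
    (hb : deg b ≠ k) : constantCoeff (v b) = 0 := by
  by_contra h
  have := hv b 0 (mem_support_iff.2 h)
  simp at this
  exact hb this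

/-- Makes the compatibility of degree parts with `Fintype.linearCombination` available for the maps
of a resolution. -/
theorem eq_linearCombination {r : ℕ} {M : Type*} [AddCommMonoid M] [Module (MvPolynomial σ K) M]
    (φ : (Fin r → MvPolynomial σ K) →ₗ[MvPolynomial σ K] M) :
    φ = Fintype.linearCombination (MvPolynomial σ K) fun b => φ (Pi.single b 1) := by
  refine LinearMap.pi_ext' fun b => LinearMap.ext_ring ?_
  simp [Fintype.linearCombination_apply_single]

namespace GradedFreeResolution

variable {I : Ideal (MvPolynomial σ K)} (F : GradedFreeResolution I)

theorem aug_mem (v : Fin (F.rank 0) → MvPolynomial σ K) : F.aug v ∈ I :=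
  F.range_aug.le (LinearMap.mem_range_self _ v)

theorem vecComp_d (i k : ℕ) (v : Fin (F.rank (i + 1)) → MvPolynomial σ K) :
    vecComp (F.deg i) k (F.d i v) = F.d i (vecComp (F.deg (i + 1)) k v) := by
  rw [eq_linearCombination (F.d i)]
  exact vecComp_linearCombination _ _ _ (F.d_homogeneous i) k v

theorem exists_homogeneous_preimage_d (i : ℕ) {k : ℕ} {s : Fin (F.rank i) → MvPolynomial σ K}
    (hs : IsHomogeneousVec (F.deg i) k s) (hmem : s ∈ LinearMap.range (F.d i)) :
    ∃ w, IsHomogeneousVec (F.deg (i + 1)) k w ∧ F.d i w = s := by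
  obtain ⟨w, rfl⟩ := hmem
  exact ⟨_, vecComp_isHomogeneousVec _ k w,
    (F.vecComp_d i k w).symm.trans (vecComp_of_isHomogeneousVec hs)⟩

theorem shiftComp_aug (k : ℕ) (v : Fin (F.rank 0) → MvPolynomial σ K) :
    shiftComp 0 k (F.aug v) = F.aug (vecComp (F.deg 0) k v) := by
  rw [eq_linearCombination F.aug]
  simp only [Fintype.linearCombination_apply, shiftComp_sum, smul_eq_mul]
  refine Finset.sum_congr rfl fun b _ => shiftComp_mul _ _ _ _ _ fun m hm => ?_
  rw [add_zero, Finsupp.degree_eq_weight_one]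
  exact F.aug_homogeneous b (mem_support_iff.1 hm)

theorem exists_homogeneous_preimage_aug {k : ℕ} {p : MvPolynomial σ K}
    (hp : p.IsHomogeneous k) (hmem : p ∈ I) :
    ∃ w, IsHomogeneousVec (F.deg 0) k w ∧ F.aug w = p := by
  rw [← F.range_aug] at hmem
  obtain ⟨w, rfl⟩ := hmem
  refine ⟨_, vecComp_isHomogeneousVec _ k w, (F.shiftComp_aug k w).symm.trans ?_⟩
  rw [shiftComp, if_pos (Nat.zero_le _), Nat.sub_zero, homogeneousComponent_of_mem hp, if_pos rfl]

variable {F}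

theorem IsMinimal.constantCoeff_of_aug_eq_zero (hF : F.IsMinimal)
    {v : Fin (F.rank 0) → MvPolynomial σ K} (hv : F.aug v = 0) (b : Fin (F.rank 0)) :
    constantCoeff (v b) = 0 := by
  obtain ⟨w, rfl⟩ : v ∈ LinearMap.range (F.d 0) := F.exact_zero ▸ LinearMap.mem_ker.2 hv
  exact hF 0 w b

theorem IsMinimal.constantCoeff_of_d_eq_zero (hF : F.IsMinimal) {i : ℕ}
    {v : Fin (F.rank (i + 1)) → MvPolynomial σ K} (hv : F.d i v = 0) (b : Fin (F.rank (i + 1))) :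
    constantCoeff (v b) = 0 := by
  obtain ⟨w, rfl⟩ : v ∈ LinearMap.range (F.d (i + 1)) :=
    F.exact_succ i ▸ LinearMap.mem_ker.2 hv
  exact hF (i + 1) w b

/-- The generators in a minimal resolution of an ideal generated by quadrics have degree two. -/
theorem IsMinimal.deg_zero_eq_two (hF : F.IsMinimal) {m : ℕ} {f : Fin m → MvPolynomial σ K}
    (hf : ∀ k, (f k).IsHomogeneous 2) (hspan : Ideal.span (Set.range f) = I)
    (b : Fin (F.rank 0)) : F.deg 0 b = 2 := by
  by_contra hne
  choose w hw hwf using fun k =>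
    F.exists_homogeneous_preimage_aug (hf k) (hspan ▸ Ideal.subset_span ⟨k, rfl⟩)
  have hmem : F.aug (Pi.single b 1) ∈ Ideal.span (Set.range f) := by
    rw [hspan]
    exact F.aug_mem _
  obtain ⟨c, hc⟩ := Ideal.mem_span_range_iff_exists_fun.1 hmem
  -- Each `w k` has degree 2, so its `b`-coordinate has no constant term; this kernel element then
  -- has constant term 1 at `b`, against minimality.
  have h0 : F.aug (Pi.single b 1 - ∑ k, c k • w k) = 0 := by
    rw [map_sub, map_sum, ← hc]
    simp [hwf]
  have := hF.constantCoeff_of_aug_eq_zero h0 b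
  simp [Finset.sum_apply, (hw _).constantCoeff_eq_zero hne] at this

/-- The first syzygies in a minimal resolution have degree at most `D` if the kernel of the
augmentation is generated by homogeneous elements of degree at most `D`. -/
theorem IsMinimal.deg_one_le (hF : F.IsMinimal) {D : ℕ}
    (hker : LinearMap.ker F.aug ≤ Submodule.span (MvPolynomial σ K)
      {s | F.aug s = 0 ∧ ∃ k ≤ D, IsHomogeneousVec (F.deg 0) k s})
    (b : Fin (F.rank 1)) : F.deg 1 b ≤ D := by
  by_contra! hlt
  -- Homogeneous kernel elements of degree at most `D` lift to vectors of the same degree, which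
  -- cannot have a constant term at a basis element of degree above `D`.
  have hle : Submodule.span (MvPolynomial σ K)
      {s | F.aug s = 0 ∧ ∃ k ≤ D, IsHomogeneousVec (F.deg 0) k s} ≤
      Submodule.map (F.d 0) (Submodule.comap (LinearMap.proj b)
        (RingHom.ker (constantCoeff (σ := σ) (R := K)) : Ideal (MvPolynomial σ K))) := by
    rw [Submodule.span_le]
    rintro s ⟨hs, k, hk, hsk⟩
    obtain ⟨w, hw, rfl⟩ := F.exists_homogeneous_preimage_d 0 hsk
      (F.exact_zero ▸ LinearMap.mem_ker.2 hs)
    exact ⟨w, hw.constantCoeff_eq_zero (hk.trans_lt hlt).ne', rfl⟩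
  have hmem : F.d 0 (Pi.single b 1) ∈ LinearMap.ker F.aug :=
    F.exact_zero ▸ LinearMap.mem_range_self _ _
  obtain ⟨w, hw, hwd⟩ := hle (hker hmem)
  have hw' : constantCoeff (w b) = 0 := hw
  have h0 : F.d 0 (Pi.single b 1 - w) = 0 := by rw [map_sub, hwd, sub_self]
  have := hF.constantCoeff_of_d_eq_zero h0 b
  simp [hw'] at this

/-- Comparison of the family `f` with the minimal generators through lifts `A` and `B` in both
directions: the kernel of the augmentation is generated by the images under `A` of quadric syzygies,
of degree 2 + 2, and by the corrections `e_b - A (B b)`, of degree 2. -/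
theorem IsMinimal.deg_one_le_four (hF : F.IsMinimal) (hI : HasQuadraticSyzygies I)
    (b : Fin (F.rank 1)) : F.deg 1 b ≤ 4 := by
  obtain ⟨m, f, hf, hspan, hsyz⟩ := hI
  refine hF.deg_one_le ?_ b
  set N := Submodule.span (MvPolynomial σ K)
    {s | F.aug s = 0 ∧ ∃ k ≤ 4, IsHomogeneousVec (F.deg 0) k s} with hN
  have hdeg := hF.deg_zero_eq_two hf hspan
  choose w hw hwf using fun k =>
    F.exists_homogeneous_preimage_aug (hf k) (hspan ▸ Ideal.subset_span ⟨k, rfl⟩)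
  -- Both families consist of quadrics, so the coefficients are scalars.
  choose B hB hBf using fun b => exists_isHomogeneous_coeff (e := 0) hf
    (p := F.aug (Pi.single b 1)) (by simpa [hdeg] using F.aug_homogeneous b)
    (by rw [hspan]; exact F.aug_mem _)
  let A : (Fin m → MvPolynomial σ K) →ₗ[MvPolynomial σ K] (Fin (F.rank 0) → MvPolynomial σ K) :=
    Fintype.linearCombination (MvPolynomial σ K) w
  have hA : ∀ c, A c = ∑ k, c k • w k := fun c => Fintype.linearCombination_apply _ _ _
  have hAaug : ∀ c, F.aug (A c) = ∑ k, c k * f k := fun c => by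
    rw [hA, map_sum]
    simp [hwf]
  have hAN : ∀ c, ∑ k, c k * f k = 0 → A c ∈ N := by
    intro c hc
    refine (Submodule.span_le (p := N.comap A)).2 (fun d hd => ?_) (hsyz c hc)
    refine Submodule.subset_span ⟨(hAaug d).trans hd.2, 4, le_rfl, ?_⟩
    rw [hA]
    exact isHomogeneousVec_sum _ fun k _ => (hw k).smul (hd.1 k)
  have hBN : ∀ b, Pi.single b 1 - A (B b) ∈ N := by
    intro b
    refine Submodule.subset_span ⟨by rw [map_sub, hAaug, hBf, sub_self], 2, by omega, ?_⟩
    refine IsHomogeneousVec.sub (by simpa [hdeg] using isHomogeneousVec_single (F.deg 0) b) ?_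
    rw [hA]
    exact isHomogeneousVec_sum _ fun k _ => by simpa using (hw k).smul (hB b k)
  intro z hz
  have hz' : z = ∑ b, z b • Pi.single b (1 : MvPolynomial σ K) := by
    funext c
    simp [Finset.sum_apply, Pi.single_apply]
  have hsplit : z = ∑ b, z b • (Pi.single b 1 - A (B b)) + A (∑ b, z b • B b) := by
    simp only [smul_sub, Finset.sum_sub_distrib, map_sum, map_smul, ← hz']
    abel
  rw [hsplit]
  refine add_mem (Submodule.sum_mem _ fun b _ => Submodule.smul_mem _ _ (hBN b)) (hAN _ ?_)
  rw [LinearMap.mem_ker, hz', map_sum] at hz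
  rw [← hAaug, map_sum, map_sum, ← hz]
  simp [hAaug, hBf]

end GradedFreeResolution

attribute [local instance] MvPolynomial.gradedAlgebra in
/-- First syzygies of an ideal with quadratic syzygies live in degree at most four. -/
theorem gradedBetti_one_eq_zero [Finite σ] {I : Ideal (MvPolynomial σ K)}
    (hI : I.IsHomogeneous (homogeneousSubmodule σ K)) (h : HasQuadraticSyzygies I) {j : ℕ} (hj : 4 < j) : gradedBetti I hI 1 j = 0 := by
  rw [gradedBetti, GradedFreeResolution.multiplicity, Fintype.card_eq_zero_iff]
  refine ⟨fun b => ?_⟩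
  have := (exists_isMinimal hI).choose_spec.deg_one_le_four h b.1
  have := b.2
  omega

end BinomialEdge

theorem mainTheorem12 (K : Type*) [Field K] {V : Type*} [Fintype V] (G : SimpleGraph V)
    (hG : G.IsAcyclic) (hV : 4 ≤ Fintype.card V) :
    ∀ j : ℕ, Fintype.card V < j →
      BinomialEdge.gradedBetti (BinomialEdge.binomialEdgeIdeal K G)
        (BinomialEdge.binomialEdgeIdeal_isHomogeneous K G) 1 j = 0 := by
  intro j hj
  -- The assumption `n ≥ 4` serves only to give `4 < j`.
  exact BinomialEdge.gradedBetti_one_eq_zero _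
    (BinomialEdge.hasQuadraticSyzygies_of_isAcyclic G hG) (hV.trans_lt hj)
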